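/- Let $\Sigma$ be a finite alphabet. An automaton over $\Sigma$ has a finite set $Q$ of states, an initial state and a transition function $\delta:Q\times\Sigma\to 2^Q$; it is deterministic if $|\delta(q,a)|\le 1$ for all $q\in Q$ and $a\in\Sigma$. With a set $F\subseteq Q$, a deterministic automaton is read as a DBA (it accepts an $\omega$-word $w\in\Sigma^\omega$ iff it has a run on $w$ that visits $F$ infinitely often) or as a DCA (it accepts $w$ iff it has a run on $w$ that visits $F$ only finitely often). Let $\mathbb{DB}$ and $\mathbb{DC}$ be the classes of $\omega$-languages accepted by DBAs and by DCAs; a language in $\mathbb{DB}\cap\mathbb{DC}$ is called weak. For $L\subseteq\Sigma^\omega$ and $x,y\in\Sigma^*$ write $x\sim_L y$ iff for all $w\in\Sigma^\omega$, $xw\in L\Leftrightarrow yw\in L$. The rightcon automaton $\mathcal R_L$ of $L$ has the classes of $\sim_L$ as states, initial state $[\epsilon]$ and transitions $[u]\xrightarrow{a}[ua]$. Let $\mathbb{IB}$ (resp. $\mathbb{IC}$) be the class of $\omega$-languages $L$ accepted by a DBA (resp. DCA) whose underlying automaton is isomorphic to $\mathcal R_L$. (1) Over every finite alphabet, $\mathbb{DB}\cap\mathbb{DC}\subseteq\mathbb{IB}$,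 $\mathbb{DB}\cap\mathbb{DC}\subseteq\mathbb{IC}$, and $\mathbb{DB}\cap\mathbb{DC}=\mathbb{IB}\cap\mathbb{IC}$. (2) Both inclusions are strict over the alphabet $\{a,b,c\}$. Let $\mathcal A$ be the deterministic automaton with states $0,1,2,3$, initial state $0$, marked set $F=\{0\}$ and transitions $0\xrightarrow{a,b,c}1$; $1\xrightarrow{a}2$, $1\xrightarrow{b,c}1$; $2\xrightarrow{a}2$, $2\xrightarrow{b}3$, $2\xrightarrow{c}1$; $3\xrightarrow{a}1$, $3\xrightarrow{b}3$, $3\xrightarrow{c}0$. Read as a DBA, $\mathcal A$ is isomorphic to the rightcon automaton of the language it accepts, and this language is in $\mathbb{IB}\setminus\mathbb{DC}$; hence $\mathbb{DB}\cap\mathbb{DC}\subsetneq\mathbb{IB}$. Read as a DCA, $\mathcal A$ is isomorphic to the rightcon automaton of the language it accepts, and this language is in $\mathbb{IC}\setminus\mathbb{DB}$; hence $\mathbb{DB}\cap\mathbb{DC}\subsetneq\mathbb{IC}$. -/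

import Mathlib

/-- An automaton over the alphabet `α` with state set `Q`: an initial state and a transition
function `Q × α → 2^Q`. Finiteness of `Q` is required where acceptors are considered. -/
structure OmegaAutomaton (α : Type*) (Q : Type*) where
  init : Q
  step : Q → α → Set Q

namespace OmegaAutomaton

/-- At most one successor for each state and letter (the automaton may be incomplete). -/
def IsDeterministic {α Q : Type*} (A : OmegaAutomaton α Q) : Prop :=
  ∀ q a, (A.step q a).Subsingleton

/-- `r` is a run of `A` on the infinite word `w`. -/
def IsRun {α Q : Type*} (A : OmegaAutomaton α Q) (w : Stream' α) (r : ℕ → Q) : Prop :=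
  r 0 = A.init ∧ ∀ i, r (i + 1) ∈ A.step (r i) (w.get i)

/-- The language accepted with the Büchi condition: some run visits `F` infinitely often. -/
def buchiLanguage {α Q : Type*} (A : OmegaAutomaton α Q) (F : Set Q) : Set (Stream' α) :=
  {w | ∃ r, A.IsRun w r ∧ {i | r i ∈ F}.Infinite}

/-- The language accepted with the co-Büchi condition: some run visits `F` only finitely often. -/
def coBuchiLanguage {α Q : Type*} (A : OmegaAutomaton α Q) (F : Set Q) : Set (Stream' α) :=
  {w | ∃ r, A.IsRun w r ∧ {i | r i ∈ F}.Finite}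

/-- Isomorphism of automata: a bijection of states that respects the initial state and the
transitions. -/
structure Iso {α Q Q' : Type*} (A : OmegaAutomaton α Q) (B : OmegaAutomaton α Q') where
  toEquiv : Q ≃ Q'
  map_init : toEquiv A.init = B.init
  map_step : ∀ q a, toEquiv '' A.step q a = B.step (toEquiv q) a

end OmegaAutomaton

/-- The canonical right congruence of an `ω`-language. -/
def rightCongruence {α : Type*} (L : Set (Stream' α)) : Setoid (List α) where
  r x y := ∀ w : Stream' α, x ++ₛ w ∈ L ↔ y ++ₛ w ∈ L
  iseqv :=
    { refl := fun _ _ => Iff.rfl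
      symm := fun h w => (h w).symm
      trans := fun h₁ h₂ w => (h₁ w).trans (h₂ w) }

theorem rightCongruence_append {α : Type*} (L : Set (Stream' α)) (v : List α) {x y : List α}
    (h : (rightCongruence L) x y) : (rightCongruence L) (x ++ v) (y ++ v) := by
  intro w
  rw [Stream'.append_append_stream, Stream'.append_append_stream]
  exact h (v ++ₛ w)

/-- The rightcon automaton of `L`: states are the classes of the right congruence, the initial
state is the class of the empty word, and `[u]` goes to `[ua]` under the letter `a`. -/
def rightcon {α : Type*} (L : Set (Stream' α)) :
    OmegaAutomaton α (Quotient (rightCongruence L)) where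
  init := Quotient.mk (rightCongruence L) []
  step q a := {Quotient.map (fun u => u ++ [a])
    (fun _ _ h => rightCongruence_append L [a] h) q}

/-- Languages accepted by deterministic Büchi automata. -/
def DB (α : Type*) : Set (Set (Stream' α)) :=
  {L | ∃ (Q : Type) (_ : Finite Q) (A : OmegaAutomaton α Q) (F : Set Q),
    A.IsDeterministic ∧ A.buchiLanguage F = L}

/-- Languages accepted by deterministic co-Büchi automata. -/
def DC (α : Type*) : Set (Set (Stream' α)) :=
  {L | ∃ (Q : Type) (_ : Finite Q) (A : OmegaAutomaton α Q) (F : Set Q),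
    A.IsDeterministic ∧ A.coBuchiLanguage F = L}

/-- Languages `L` accepted by a deterministic Büchi automaton isomorphic to the rightcon
automaton of `L`. -/
def IB (α : Type*) : Set (Set (Stream' α)) :=
  {L | ∃ (Q : Type) (_ : Finite Q) (A : OmegaAutomaton α Q) (F : Set Q),
    A.IsDeterministic ∧ A.buchiLanguage F = L ∧ Nonempty ((rightcon L).Iso A)}

/-- Languages `L` accepted by a deterministic co-Büchi automaton isomorphic to the rightcon
automaton of `L`. -/
def IC (α : Type*) : Set (Set (Stream' α)) :=
  {L | ∃ (Q : Type) (_ : Finite Q) (A : OmegaAutomaton α Q) (F : Set Q),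
    A.IsDeterministic ∧ A.coBuchiLanguage F = L ∧ Nonempty ((rightcon L).Iso A)}

/-- A four-state automaton over the letters `a = 0`, `b = 1`, `c = 2`. Row `q` of the table lists
the successors of state `q` under `a`, `b`, `c`. -/
def fourState : OmegaAutomaton (Fin 3) (Fin 4) where
  init := 0
  step q x := {(![![1, 1, 1], ![2, 1, 1], ![2, 3, 1], ![1, 3, 0]] : Fin 4 → Fin 3 → Fin 4) q x}

/-!
A language `L` is deterministic Büchi only if it is a limit `prefixLimit W` (the words with
infinitely many prefixes in `W`), and deterministic co-Büchi only if its complement is one; in both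
cases `W` is recognized by the subset construction, so `L` has a finite rightcon automaton.

Suppose that `L = prefixLimit W` and `Lᶜ = prefixLimit W'`, and let `x`, `x'` be words read from one
state `q` of the rightcon automaton whose runs never leave the strongly connected component of
`q`. If `x` were accepted from `q` and `x'` rejected, then one could follow `x` until a prefix in
`W` is met, return to `q`, follow `x'` until a prefix in `W'` is met, return to `q`, and so on: the
resulting word would lie in both limits (`append_mem_iff_of_isRecurrent`). Every run of a finite
automaton ends up in one strongly connected component, so acceptance depends on that component
alone, and marking the accepting components, respectively the others, turns the rightcon automaton
into a Büchi, respectively co-Büchi, acceptor of `L` (`languages_rightcon_acceptingClasses`).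

For strictness, both readings of the four-state automaton have complementary languages and the same
right congruence. The word `(ababc)^ω` is accepted from state `0` and rejected from state `1` under
the Büchi condition, and any two distinct states can be led to the pair of `0` and `1` by a common
word; so distinct states are inequivalent, and the rightcon automaton is the automaton itself. It
is strongly connected, so by the above a weak language would have to contain all words or none
(`fourState.not_prefixLimit_compl`).
-/

open Filter

/-! ### Limits of languages of finite words -/

/-- The limit of a language `W` of finite words: the infinite words with infinitely many prefixes
in `W`. -/
def prefixLimit {α : Type*} (W : Language α) : Set (Stream' α) :=
  {w | ∃ᶠ n in atTop, w.take n ∈ W}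

theorem Stream'.take_length_add_append {α : Type*} (u : List α) (w : Stream' α) (n : ℕ) :
    (u ++ₛ w).take (u.length + n) = u ++ w.take n := by
  induction u with
  | nil => simp
  | cons a u ih =>
    rw [List.length_cons, Nat.add_right_comm]
    simpa [Stream'.take_succ, Stream'.cons_append_stream] using ih

theorem Filter.frequently_atTop_add_left {p : ℕ → Prop} (k : ℕ) :
    (∃ᶠ n in atTop, p (k + n)) ↔ ∃ᶠ n in atTop, p n := by
  conv_rhs => rw [← map_add_atTop_eq_nat k, frequently_map]
  simp only [Nat.add_comm k]

theorem append_mem_prefixLimit {α : Type*} {W : Language α} (u : List α) (w : Stream' α) :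
    u ++ₛ w ∈ prefixLimit W ↔ ∃ᶠ n in atTop, u ++ w.take n ∈ W := by
  rw [prefixLimit, Set.mem_ofPred_eq, ← frequently_atTop_add_left u.length]
  simp only [Stream'.take_length_add_append]

/-- A chain of ever longer prefixes has a limit word. -/
theorem exists_stream_of_prefix_chain {α : Type*} (v : ℕ → List α)
    (hv : ∀ n, v n <+: v (n + 1)) (hl : ∀ n, n ≤ (v n).length) :
    ∃ w : Stream' α, ∀ n, w.take (v n).length = v n := by
  have mono : ∀ m n, m ≤ n → v m <+: v n := by
    intro m n h
    induction n, h using Nat.le_induction with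
    | base => exact List.prefix_rfl
    | succ n _ ih => exact ih.trans (hv n)
  obtain ⟨w, hw⟩ : ∃ w : Stream' α, ∀ i, w.get i = (v (i + 1))[i]'(hl (i + 1)) :=
    ⟨fun i => (v (i + 1))[i]'(hl (i + 1)), fun _ => rfl⟩
  refine ⟨w, fun n => ?_⟩
  refine List.ext_getElem? fun i => ?_
  by_cases hi : i < (v n).length
  · rw [Stream'.getElem?_take hi, List.getElem?_eq_getElem hi, hw]
    congr 1
    rcases le_total (i + 1) n with h | h
    · exact (mono _ _ h).getElem (hl (i + 1))
    · exact ((mono _ _ h).getElem hi).symm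
  · rw [List.getElem?_eq_none (by simpa using hi), List.getElem?_eq_none (by simpa using hi)]

/-- If from every word satisfying `P` one can pass through `W`, then through `W'`, and end in
`P` again, then alternating between the two produces a common element of both limits. -/
theorem prefixLimit_inter_nonempty {α : Type*} {W W' : Language α} {P : List α → Prop}
    {u₀ : List α} (h₀ : P u₀)
    (hW : ∀ u, P u → ∃ z y, z ≠ [] ∧ u ++ z ∈ W ∧ P (u ++ z ++ y))
    (hW' : ∀ u, P u → ∃ z y, z ≠ [] ∧ u ++ z ∈ W' ∧ P (u ++ z ++ y)) :
    (prefixLimit W ∩ prefixLimit W').Nonempty := by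
  have step : ∀ u : {u // P u}, ∃ v : {u // P u}, u.1 <+: v.1 ∧ u.1.length < v.1.length ∧
      (∃ z ∈ W, z <+: v.1 ∧ u.1.length < z.length) ∧
      ∃ z ∈ W', z <+: v.1 ∧ u.1.length < z.length := by
    rintro ⟨u, hu⟩
    obtain ⟨z, y, hz, hzW, hP⟩ := hW u hu
    obtain ⟨z', y', hz', hzW', hP'⟩ := hW' _ hP
    have := List.length_pos_iff.2 hz
    have := List.length_pos_iff.2 hz'
    refine ⟨⟨_, hP'⟩, by simp [List.append_assoc], by simp; omega,
      ⟨u ++ z, hzW, ?_, by simp; omega⟩,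
      ⟨_, hzW', List.prefix_append _ _, by simp; omega⟩⟩
    simp only [List.append_assoc]
    rw [← List.append_assoc u z]
    exact List.prefix_append _ _
  choose next hpre hlen hz hz' using step
  let v : ℕ → {u // P u} := fun n => next^[n] ⟨u₀, h₀⟩
  have hs : ∀ n, v (n + 1) = next (v n) := fun n => Function.iterate_succ_apply' _ _ _
  have hl : ∀ n, n ≤ (v n).1.length := by
    intro n
    induction n with
    | zero => exact Nat.zero_le _
    | succ n ih =>
      rw [hs]
      exact lt_of_le_of_lt ih (hlen _)
  obtain ⟨w, hw⟩ := exists_stream_of_prefix_chain (fun n => (v n).1)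
    (fun n => by simp only [hs]; exact hpre _) hl
  have key : ∀ V : Language α,
      (∀ u : {u // P u}, ∃ z ∈ V, z <+: (next u).1 ∧ u.1.length < z.length) →
      w ∈ prefixLimit V := by
    intro V hV
    refine frequently_atTop.2 fun n => ?_
    obtain ⟨z, hzV, hzp, hzl⟩ := hV (v n)
    refine ⟨z.length, ((hl n).trans_lt hzl).le, ?_⟩
    have h1 : z <+: w.take (v (n + 1)).1.length := by rw [hw, hs]; exact hzp
    have h2 := List.prefix_iff_eq_take.1 h1
    have h3 := h1.length_le
    rw [Stream'.length_take] at h3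
    rw [Stream'.take_take, min_eq_right h3] at h2
    rwa [← h2]
  exact ⟨w, key W hz, key W' hz'⟩

/-! ### Recurrent words -/

/-- After the prefix `u`, the run of the rightcon automaton of `L` on `x` never leaves the
strongly connected component of the class of `u`. -/
def IsRecurrent {α : Type*} (L : Set (Stream' α)) (u : List α) (x : Stream' α) : Prop :=
  ∀ n, ∃ y, rightCongruence L (u ++ x.take n ++ y) u

/-- If both `L` and its complement are limits, then membership in `L` does not separate two
recurrent words issuing from one state of the rightcon automaton. Otherwise, from any word
congruent to `u`, following `x` passes through `W`, following `x'` passes through `W'`, and one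
can return to the class of `u` after either. -/
theorem append_mem_iff_of_isRecurrent {α : Type*} {L : Set (Stream' α)} {W W' : Language α}
    (hL : L = prefixLimit W) (hL' : Lᶜ = prefixLimit W') {u : List α} {x x' : Stream' α}
    (hx : IsRecurrent L u x) (hx' : IsRecurrent L u x') (h : u ++ₛ x ∈ L) : u ++ₛ x' ∈ L := by
  by_contra h'
  have key : ∀ (K : Set (Stream' α)) (V : Language α) (x : Stream' α), K = prefixLimit V →
      IsRecurrent L u x → (∀ v, rightCongruence L v u → v ++ₛ x ∈ K) →
      ∀ v, rightCongruence L v u →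
        ∃ z y, z ≠ [] ∧ v ++ z ∈ V ∧ rightCongruence L (v ++ z ++ y) u := by
    intro K V x hK hx hv v hvu
    have hm := hv v hvu
    rw [hK, append_mem_prefixLimit] at hm
    obtain ⟨n, hn, hnV⟩ := frequently_atTop.1 hm 1
    obtain ⟨y, hy⟩ := hx n
    refine ⟨x.take n, y, ?_, hnV, ?_⟩
    · rw [← List.length_pos_iff, Stream'.length_take]
      exact hn
    · refine (rightCongruence L).trans ?_ hy
      rw [List.append_assoc, List.append_assoc]
      exact rightCongruence_append L _ hvu
  obtain ⟨w, hw, hw'⟩ := prefixLimit_inter_nonempty (P := fun v => rightCongruence L v u)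
    ((rightCongruence L).refl u)
    (key L W x hL hx fun v hv => (hv x).2 h)
    (key Lᶜ W' x' hL' hx' fun v hv hv' => h' ((hv x').1 hv'))
  rw [← hL] at hw
  rw [← hL'] at hw'
  exact hw' hw

/-! ### Runs of deterministic automata -/

namespace OmegaAutomaton

variable {α Q : Type*} {A : OmegaAutomaton α Q}

theorem IsRun.unique (hA : A.IsDeterministic) {w : Stream' α} {r r' : ℕ → Q}
    (h : A.IsRun w r) (h' : A.IsRun w r') : r = r' := by
  funext n
  induction n with
  | zero => rw [h.1, h'.1]
  | succ n ih => exact hA _ _ (h.2 n) (ih ▸ h'.2 n)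

theorem mem_buchiLanguage_iff (hA : A.IsDeterministic) {w : Stream' α} {r : ℕ → Q}
    (h : A.IsRun w r) (F : Set Q) :
    w ∈ A.buchiLanguage F ↔ ∃ᶠ n in atTop, r n ∈ F := by
  rw [Nat.frequently_atTop_iff_infinite]
  exact ⟨fun ⟨r', h', hF⟩ => h.unique hA h' ▸ hF, fun hF => ⟨r, h, hF⟩⟩

theorem mem_coBuchiLanguage_iff (hA : A.IsDeterministic) {w : Stream' α} {r : ℕ → Q}
    (h : A.IsRun w r) (F : Set Q) :
    w ∈ A.coBuchiLanguage F ↔ ¬ ∃ᶠ n in atTop, r n ∈ F := by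
  rw [Nat.frequently_atTop_iff_infinite, Set.not_infinite]
  exact ⟨fun ⟨r', h', hF⟩ => h.unique hA h' ▸ hF, fun hF => ⟨r, h, hF⟩⟩

/-- The subset construction, as an automaton on finite words with accepting sets `T`. -/
def toDFA (A : OmegaAutomaton α Q) (T : Set (Set Q)) : DFA α (Set Q) where
  step S a := ⋃ q ∈ S, A.step q a
  start := {A.init}
  accept := T

theorem IsRun.eval_toDFA (hA : A.IsDeterministic) {w : Stream' α} {r : ℕ → Q}
    (h : A.IsRun w r) (T : Set (Set Q)) (n : ℕ) : (A.toDFA T).eval (w.take n) = {r n} := by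
  induction n with
  | zero => simp [toDFA, h.1]
  | succ n ih =>
    rw [Stream'.take_succ', DFA.eval_append_singleton, ih]
    simp only [toDFA, Set.mem_singleton_iff, Set.iUnion_iUnion_eq_left]
    exact (hA _ _).eq_singleton_of_mem (h.2 n)

/-- A word on which an automaton has no run leads the subset construction to the empty set,
which is then never left. -/
theorem exists_isRun_or_eventually_eval_eq_empty (hA : A.IsDeterministic) (w : Stream' α)
    (T : Set (Set Q)) :
    (∃ r, A.IsRun w r) ∨ ∀ᶠ n in atTop, (A.toDFA T).eval (w.take n) = ∅ := by
  have hsucc : ∀ n, (A.toDFA T).eval (w.take (n + 1)) =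
      ⋃ q ∈ (A.toDFA T).eval (w.take n), A.step q (w.get n) := by
    intro n
    rw [Stream'.take_succ', DFA.eval_append_singleton]
    rfl
  by_cases hne : ∀ n, ((A.toDFA T).eval (w.take n)).Nonempty
  · left
    have hsub : ∀ n, ((A.toDFA T).eval (w.take n)).Subsingleton := by
      intro n
      induction n with
      | zero => simp [toDFA]
      | succ n ih =>
        rw [hsucc]
        intro p hp p' hp'
        simp only [Set.mem_iUnion, exists_prop] at hp hp'
        obtain ⟨q, hq, hp⟩ := hp
        obtain ⟨q', hq', hp'⟩ := hp'
        exact hA q _ hp (ih hq' hq ▸ hp')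
    choose r hr using hne
    refine ⟨r, by simpa [toDFA] using hr 0, fun n => ?_⟩
    have h := hr (n + 1)
    rw [hsucc] at h
    simp only [Set.mem_iUnion, exists_prop] at h
    obtain ⟨q, hq, hp⟩ := h
    exact hsub n hq (hr n) ▸ hp
  · right
    push Not at hne
    obtain ⟨N, hN⟩ := hne
    filter_upwards [eventually_ge_atTop N] with n hn
    induction n, hn using Nat.le_induction with
    | base => exact hN
    | succ n _ ih => rw [hsucc, ih]; simp

theorem buchiLanguage_eq_prefixLimit (hA : A.IsDeterministic) (F : Set Q) :
    A.buchiLanguage F = prefixLimit (A.toDFA {S | ∃ q ∈ S, q ∈ F}).accepts := by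
  ext w
  rcases exists_isRun_or_eventually_eval_eq_empty hA w {S | ∃ q ∈ S, q ∈ F} with ⟨r, hr⟩ | h
  · rw [mem_buchiLanguage_iff hA hr]
    simp only [prefixLimit, Set.mem_ofPred_eq, DFA.mem_accepts, hr.eval_toDFA hA]
    simp [toDFA]
  · refine iff_of_false ?_ ?_
    · rintro ⟨r, hr, -⟩
      obtain ⟨n, hn⟩ := h.exists
      simp [hr.eval_toDFA hA] at hn
    · refine not_frequently.2 (h.mono fun n hn => ?_)
      rw [DFA.mem_accepts, hn]
      simp [toDFA]

/-- The complement of a deterministic co-Büchi language is a limit: a word is rejected when its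
run visits `F` infinitely often or breaks off, and the empty set counts as accepting for the
sake of the latter. -/
theorem compl_coBuchiLanguage_eq_prefixLimit (hA : A.IsDeterministic) (F : Set Q) :
    (A.coBuchiLanguage F)ᶜ = prefixLimit (A.toDFA {S | S ⊆ F}).accepts := by
  ext w
  rcases exists_isRun_or_eventually_eval_eq_empty hA w {S | S ⊆ F} with ⟨r, hr⟩ | h
  · rw [Set.mem_compl_iff, mem_coBuchiLanguage_iff hA hr, not_not]
    simp only [prefixLimit, Set.mem_ofPred_eq, DFA.mem_accepts, hr.eval_toDFA hA]
    simp [toDFA]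
  · refine iff_of_true ?_ ?_
    · rintro ⟨r, hr, -⟩
      obtain ⟨n, hn⟩ := h.exists
      simp [hr.eval_toDFA hA] at hn
    · refine (h.mono fun n hn => ?_).frequently
      rw [DFA.mem_accepts, hn]
      simp [toDFA]

theorem Iso.isRun_comp_iff {Q' : Type*} {B : OmegaAutomaton α Q'} (e : A.Iso B)
    {w : Stream' α} {r : ℕ → Q} : B.IsRun w (e.toEquiv ∘ r) ↔ A.IsRun w r := by
  simp [IsRun, ← e.map_init, ← e.map_step]

theorem Iso.buchiLanguage_eq {Q' : Type*} {B : OmegaAutomaton α Q'} (e : A.Iso B)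
    (F : Set Q') : B.buchiLanguage F = A.buchiLanguage (e.toEquiv ⁻¹' F) := by
  ext w
  exact e.toEquiv.surjective.comp_left.exists.trans
    (exists_congr fun r => and_congr_left fun _ => e.isRun_comp_iff)

theorem Iso.coBuchiLanguage_eq {Q' : Type*} {B : OmegaAutomaton α Q'} (e : A.Iso B)
    (F : Set Q') : B.coBuchiLanguage F = A.coBuchiLanguage (e.toEquiv ⁻¹' F) := by
  ext w
  exact e.toEquiv.surjective.comp_left.exists.trans
    (exists_congr fun r => and_congr_left fun _ => e.isRun_comp_iff)

end OmegaAutomaton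

/-! ### The rightcon automaton of a weak language -/

theorem rightCongruence_of_eval_eq {α σ : Type*} {L : Set (Stream' α)} {M : DFA α σ}
    (hL : L = prefixLimit M.accepts) {u v : List α} (h : M.eval u = M.eval v) :
    rightCongruence L u v := by
  intro w
  rw [hL, append_mem_prefixLimit, append_mem_prefixLimit]
  simp only [DFA.mem_accepts, DFA.eval, DFA.evalFrom_of_append] at h ⊢
  rw [h]

theorem finite_quotient_rightCongruence {α σ : Type*} [Finite σ] {L : Set (Stream' α)}
    {M : DFA α σ} (hL : L = prefixLimit M.accepts) : Finite (Quotient (rightCongruence L)) := by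
  refine Finite.of_injective (fun q => M.eval q.out) fun q q' h => ?_
  exact Quotient.out_equiv_out.1 (rightCongruence_of_eval_eq hL h)

theorem isDeterministic_rightcon {α : Type*} (L : Set (Stream' α)) :
    (rightcon L).IsDeterministic := fun _ _ => Set.subsingleton_singleton

theorem isRun_rightcon {α : Type*} (L : Set (Stream' α)) (w : Stream' α) :
    (rightcon L).IsRun w fun n => Quotient.mk _ (w.take n) := by
  refine ⟨rfl, fun n => ?_⟩
  simp only [Stream'.take_succ']
  rfl

/-- A tail of a run of the rightcon automaton is recurrent if it starts in a state that the
run visits infinitely often. -/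
theorem isRecurrent_drop {α : Type*} {L : Set (Stream' α)} {u : List α} {w : Stream' α} {n : ℕ}
    (hn : rightCongruence L (w.take n) u)
    (h : ∃ᶠ m in atTop, rightCongruence L (w.take m) u) : IsRecurrent L u (w.drop n) := by
  intro k
  obtain ⟨m, hm, hmu⟩ := frequently_atTop.1 h (n + k)
  obtain ⟨l, rfl⟩ := Nat.exists_eq_add_of_le hm
  refine ⟨(w.drop (n + k)).take l, ?_⟩
  rw [Stream'.take_add, Stream'.take_add] at hmu
  refine (rightCongruence L).trans ?_ hmu
  simp only [List.append_assoc]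
  exact rightCongruence_append L _ ((rightCongruence L).symm hn)

/-- The states of the rightcon automaton of `L` from which some recurrent word is accepted.
They form a union of strongly connected components. -/
def acceptingClasses {α : Type*} (L : Set (Stream' α)) : Set (Quotient (rightCongruence L)) :=
  {q | ∃ (u : List α) (x : Stream' α), Quotient.mk _ u = q ∧ IsRecurrent L u x ∧ u ++ₛ x ∈ L}

section Weak

variable {α : Type*} {L : Set (Stream' α)}

theorem mem_acceptingClasses_of_frequently {w : Stream' α} (hw : w ∈ L)
    {c : Quotient (rightCongruence L)}
    (hc : ∃ᶠ n in atTop, Quotient.mk _ (w.take n) = c) : c ∈ acceptingClasses L := by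
  obtain ⟨n, rfl⟩ := hc.exists
  exact ⟨w.take n, w.drop n, rfl, isRecurrent_drop ((rightCongruence L).refl _)
    (hc.mono fun m hm => Quotient.exact hm), by rwa [Stream'.append_take_drop]⟩

theorem mem_of_frequently_mem_acceptingClasses {W W' : Language α}
    [Finite (Quotient (rightCongruence L))] (hL : L = prefixLimit W)
    (hL' : Lᶜ = prefixLimit W') {w : Stream' α}
    (h : ∃ᶠ n in atTop, Quotient.mk _ (w.take n) ∈ acceptingClasses L) : w ∈ L := by
  obtain ⟨c, hc⟩ := frequently_exists.1 (h.mono fun n hn => ⟨_, hn, rfl⟩ :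
    ∃ᶠ n in atTop, ∃ c, c ∈ acceptingClasses L ∧ Quotient.mk _ (w.take n) = c)
  obtain ⟨-, ⟨u, x, rfl, hx, hux⟩, -⟩ := hc.exists
  have hc' : ∃ᶠ n in atTop, rightCongruence L (w.take n) u :=
    hc.mono fun n hn => Quotient.exact hn.2
  obtain ⟨n, hn⟩ := hc'.exists
  have := append_mem_iff_of_isRecurrent hL hL' hx (isRecurrent_drop hn hc') hux
  rwa [← hn (w.drop n), Stream'.append_take_drop] at this

/-- A run of the rightcon automaton of a weak language cannot visit `acceptingClasses L` and
its complement infinitely often each. Hence this set works for both acceptance conditions. -/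
theorem languages_rightcon_acceptingClasses {W W' : Language α}
    [Finite (Quotient (rightCongruence L))] (hL : L = prefixLimit W)
    (hL' : Lᶜ = prefixLimit W') :
    (rightcon L).buchiLanguage (acceptingClasses L) = L ∧
      (rightcon L).coBuchiLanguage (acceptingClasses L)ᶜ = L := by
  have key : ∀ {w : Stream' α}, w ∈ L →
      ∀ᶠ n in atTop, Quotient.mk _ (w.take n) ∈ acceptingClasses L := by
    intro w hw
    by_contra h
    obtain ⟨c, hc⟩ := frequently_exists.1 ((not_eventually.1 h).mono fun n hn => ⟨_, hn, rfl⟩ :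
      ∃ᶠ n in atTop, ∃ c, c ∉ acceptingClasses L ∧ Quotient.mk _ (w.take n) = c)
    obtain ⟨-, hcF, -⟩ := hc.exists
    exact hcF (mem_acceptingClasses_of_frequently hw (hc.mono fun _ hn => hn.2))
  constructor <;> ext w
  · rw [OmegaAutomaton.mem_buchiLanguage_iff (isDeterministic_rightcon L) (isRun_rightcon L w)]
    exact ⟨mem_of_frequently_mem_acceptingClasses hL hL', fun hw => (key hw).frequently⟩
  · rw [OmegaAutomaton.mem_coBuchiLanguage_iff (isDeterministic_rightcon L) (isRun_rightcon L w)]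
    simp only [Set.mem_compl_iff, not_frequently, not_not]
    exact ⟨fun h => mem_of_frequently_mem_acceptingClasses hL hL' h.frequently, key⟩

end Weak

theorem exists_dfa_of_mem_DB {α : Type*} {L : Set (Stream' α)} (h : L ∈ DB α) :
    ∃ (σ : Type) (_ : Finite σ) (M : DFA α σ), L = prefixLimit M.accepts := by
  obtain ⟨Q, _, A, F, hA, rfl⟩ := h
  exact ⟨Set Q, inferInstance, _, A.buchiLanguage_eq_prefixLimit hA F⟩

theorem exists_dfa_of_mem_DC {α : Type*} {L : Set (Stream' α)} (h : L ∈ DC α) :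
    ∃ (σ : Type) (_ : Finite σ) (M : DFA α σ), Lᶜ = prefixLimit M.accepts := by
  obtain ⟨Q, _, A, F, hA, rfl⟩ := h
  exact ⟨Set Q, inferInstance, _, A.compl_coBuchiLanguage_eq_prefixLimit hA F⟩

/-- A finite rightcon automaton is isomorphic to a deterministic automaton with states in
`Fin n`, whatever universe the alphabet lives in. -/
theorem exists_iso_rightcon {α : Type*} (L : Set (Stream' α))
    [Finite (Quotient (rightCongruence L))] :
    ∃ (n : ℕ) (A : OmegaAutomaton α (Fin n)), A.IsDeterministic ∧
      Nonempty ((rightcon L).Iso A) := by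
  let e := Finite.equivFin (Quotient (rightCongruence L))
  refine ⟨_, ⟨e (rightcon L).init, fun q a => e '' (rightcon L).step (e.symm q) a⟩,
    fun q a => (isDeterministic_rightcon L _ a).image _, ⟨⟨e, rfl, fun q a => by simp⟩⟩⟩

theorem mem_IB_and_mem_IC_of_mem_DB_of_mem_DC {α : Type*} {L : Set (Stream' α)}
    (hB : L ∈ DB α) (hC : L ∈ DC α) : L ∈ IB α ∧ L ∈ IC α := by
  obtain ⟨σ, _, M, hM⟩ := exists_dfa_of_mem_DB hB
  obtain ⟨_, _, M', hM'⟩ := exists_dfa_of_mem_DC hC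
  have := finite_quotient_rightCongruence hM
  obtain ⟨n, A, hA, ⟨e⟩⟩ := exists_iso_rightcon L
  obtain ⟨h₁, h₂⟩ := languages_rightcon_acceptingClasses hM hM'
  refine ⟨⟨Fin n, inferInstance, A, e.toEquiv '' acceptingClasses L, hA, ?_, ⟨e⟩⟩,
    ⟨Fin n, inferInstance, A, (e.toEquiv '' acceptingClasses L)ᶜ, hA, ?_, ⟨e⟩⟩⟩
  · rw [e.buchiLanguage_eq, e.toEquiv.preimage_image, h₁]
  · rw [e.coBuchiLanguage_eq, Set.preimage_compl, e.toEquiv.preimage_image, h₂]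

theorem IB_subset_DB {α : Type*} : IB α ⊆ DB α :=
  fun _ ⟨Q, hQ, A, F, hA, hL, _⟩ => ⟨Q, hQ, A, F, hA, hL⟩

theorem IC_subset_DC {α : Type*} : IC α ⊆ DC α :=
  fun _ ⟨Q, hQ, A, F, hA, hL, _⟩ => ⟨Q, hQ, A, F, hA, hL⟩

/-! ### The four-state automaton -/

namespace fourState

/-- The transition function of `fourState`, as a complete automaton on finite words that
accepts in the marked state `0`. -/
def dfa : DFA (Fin 3) (Fin 4) where
  step := ![![1, 1, 1], ![2, 1, 1], ![2, 3, 1], ![1, 3, 0]]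
  start := 0
  accept := {0}

theorem isDeterministic : fourState.IsDeterministic := fun _ _ => Set.subsingleton_singleton

theorem isRun_eval (w : Stream' (Fin 3)) : fourState.IsRun w fun n => dfa.eval (w.take n) := by
  refine ⟨rfl, fun n => ?_⟩
  simp only [Stream'.take_succ', DFA.eval_append_singleton]
  rfl

theorem buchiLanguage_eq : fourState.buchiLanguage {0} = prefixLimit dfa.accepts := by
  ext w
  exact OmegaAutomaton.mem_buchiLanguage_iff isDeterministic (isRun_eval w) _

theorem coBuchiLanguage_eq : fourState.coBuchiLanguage {0} = (prefixLimit dfa.accepts)ᶜ := by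
  ext w
  exact OmegaAutomaton.mem_coBuchiLanguage_iff isDeterministic (isRun_eval w) _

/-- The periodic word `(ababc)^ω`. -/
def sepWord : Stream' (Fin 3) := fun n => ![0, 1, 0, 1, 2] (Fin.ofNat 5 n)

theorem evalFrom_take_sepWord {q : Fin 4} {r : Fin 5 → Fin 4} (h₀ : r 0 = q)
    (h : ∀ i, r (i + 1) = dfa.step (r i) (![0, 1, 0, 1, 2] i)) (n : ℕ) :
    dfa.evalFrom q (sepWord.take n) = r (Fin.ofNat 5 n) := by
  induction n with
  | zero => exact h₀.symm
  | succ n ih =>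
    rw [Stream'.take_succ', DFA.evalFrom_append_singleton, ih]
    have : Fin.ofNat 5 (n + 1) = Fin.ofNat 5 n + 1 := by
      ext
      simp [Fin.val_add]
    rw [this, h]
    rfl

/-- The run from state `0` on `(ababc)^ω` is the cycle `0, 1, 1, 2, 3`. -/
theorem frequently_evalFrom_zero :
    ∃ᶠ n in atTop, dfa.evalFrom 0 (sepWord.take n) ∈ dfa.accept := by
  refine frequently_atTop.2 fun n => ⟨5 * n, by omega, ?_⟩
  rw [evalFrom_take_sepWord (q := 0) (r := ![0, 1, 1, 2, 3]) rfl (by decide)]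
  have : Fin.ofNat 5 (5 * n) = 0 := by ext; simp
  rw [this]
  rfl

/-- The run from state `1` on `(ababc)^ω` is the cycle `1, 2, 3, 1, 1`. -/
theorem not_frequently_evalFrom_one :
    ¬ ∃ᶠ n in atTop, dfa.evalFrom 1 (sepWord.take n) ∈ dfa.accept := by
  refine not_frequently.2 (Eventually.of_forall fun n => ?_)
  rw [evalFrom_take_sepWord (q := 1) (r := ![1, 2, 3, 1, 1]) rfl (by decide)]
  exact (by decide : ∀ i, (![1, 2, 3, 1, 1] : Fin 5 → Fin 4) i ≠ 0) _

theorem append_mem_prefixLimit_iff {u : List (Fin 3)} {q : Fin 4} (h : dfa.eval u = q)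
    (w : Stream' (Fin 3)) :
    u ++ₛ w ∈ prefixLimit dfa.accepts ↔
      ∃ᶠ n in atTop, dfa.evalFrom q (w.take n) ∈ dfa.accept := by
  simp only [append_mem_prefixLimit, DFA.mem_accepts, DFA.eval, DFA.evalFrom_of_append] at h ⊢
  rw [h]

/-- Two different states are led by a common word to the pair of states `0` and `1`, which
`(ababc)^ω` separates. -/
theorem eval_eq_of_rightCongruence {u v : List (Fin 3)}
    (h : rightCongruence (prefixLimit dfa.accepts) u v) : dfa.eval u = dfa.eval v := by
  by_contra hne
  have sep : ∀ q q' : Fin 4, q ≠ q' → ∃ z ∈ ([[], [2], [1, 2]] : List (List (Fin 3))),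
      dfa.evalFrom q z = 0 ∧ dfa.evalFrom q' z = 1 ∨
        dfa.evalFrom q z = 1 ∧ dfa.evalFrom q' z = 0 := by
    decide
  obtain ⟨z, -, hz⟩ := sep _ _ hne
  simp only [DFA.eval, ← DFA.evalFrom_of_append] at hz
  have hz' := rightCongruence_append _ z h sepWord
  rcases hz with ⟨hu, hv⟩ | ⟨hu, hv⟩ <;>
    rw [append_mem_prefixLimit_iff hu, append_mem_prefixLimit_iff hv] at hz'
  · exact not_frequently_evalFrom_one (hz'.1 frequently_evalFrom_zero)
  · exact not_frequently_evalFrom_one (hz'.2 frequently_evalFrom_zero)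

theorem rightCongruence_iff {u v : List (Fin 3)} :
    rightCongruence (prefixLimit dfa.accepts) u v ↔ dfa.eval u = dfa.eval v :=
  ⟨eval_eq_of_rightCongruence, rightCongruence_of_eval_eq rfl⟩

theorem rightCongruence_compl {α : Type*} (L : Set (Stream' α)) :
    rightCongruence Lᶜ = rightCongruence L := by
  ext u v
  exact forall_congr' fun w => not_iff_not

/-- An automaton isomorphism from the rightcon automaton sends the class of `u` to the state
reached by `u`. -/
theorem nonempty_iso {L : Set (Stream' (Fin 3))}
    (hL : ∀ u v, rightCongruence L u v ↔ dfa.eval u = dfa.eval v) :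
    Nonempty ((rightcon L).Iso fourState) := by
  let f : Quotient (rightCongruence L) → Fin 4 :=
    Quotient.lift dfa.eval fun u v h => (hL u v).1 h
  have hf : Function.Bijective f := by
    constructor
    · rintro ⟨u⟩ ⟨v⟩ h
      exact Quotient.sound ((hL u v).2 h)
    · have reach : ∀ q : Fin 4, ∃ u ∈ ([[], [0], [0, 0], [0, 0, 1]] : List (List (Fin 3))),
          dfa.eval u = q := by
        decide
      intro q
      obtain ⟨u, -, hu⟩ := reach q
      exact ⟨Quotient.mk _ u, hu⟩
  refine ⟨⟨Equiv.ofBijective f hf, rfl, ?_⟩⟩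
  rintro ⟨u⟩ a
  refine Set.image_singleton.trans (congrArg _ ?_)
  exact dfa.eval_append_singleton u a

/-- As the automaton is strongly connected, all words are recurrent, and a weak language would
contain all words or none. -/
theorem not_prefixLimit_compl (W : Language (Fin 3)) :
    (prefixLimit dfa.accepts)ᶜ ≠ prefixLimit W := by
  intro hW
  have conn : ∀ q : Fin 4, ∃ y ∈ ([[], [0, 0, 1, 2], [1, 2], [2]] : List (List (Fin 3))),
      dfa.evalFrom q y = 0 := by
    decide
  have hrec : ∀ x, IsRecurrent (prefixLimit dfa.accepts) [] x := by
    intro x n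
    obtain ⟨y, -, hy⟩ := conn (dfa.eval ([] ++ x.take n))
    refine ⟨y, rightCongruence_iff.2 ?_⟩
    rw [DFA.eval, DFA.evalFrom_of_append]
    exact hy
  have h := append_mem_iff_of_isRecurrent rfl hW (hrec sepWord) (hrec ([1] ++ₛ sepWord))
    ((append_mem_prefixLimit_iff rfl _).2 frequently_evalFrom_zero)
  exact not_frequently_evalFrom_one ((append_mem_prefixLimit_iff (u := [1]) rfl _).1 h)

theorem nonempty_iso_buchi :
    Nonempty ((rightcon (fourState.buchiLanguage {0})).Iso fourState) := by
  rw [buchiLanguage_eq]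
  exact nonempty_iso fun _ _ => rightCongruence_iff

theorem nonempty_iso_coBuchi :
    Nonempty ((rightcon (fourState.coBuchiLanguage {0})).Iso fourState) := by
  rw [coBuchiLanguage_eq]
  refine nonempty_iso fun _ _ => ?_
  rw [rightCongruence_compl]
  exact rightCongruence_iff

theorem buchiLanguage_mem : fourState.buchiLanguage {0} ∈ IB (Fin 3) \ DC (Fin 3) := by
  refine ⟨⟨Fin 4, inferInstance, fourState, {0}, isDeterministic, rfl, nonempty_iso_buchi⟩,
    fun h => ?_⟩
  obtain ⟨_, _, M, hM⟩ := exists_dfa_of_mem_DC h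
  rw [buchiLanguage_eq] at hM
  exact not_prefixLimit_compl _ hM

theorem coBuchiLanguage_mem : fourState.coBuchiLanguage {0} ∈ IC (Fin 3) \ DB (Fin 3) := by
  refine ⟨⟨Fin 4, inferInstance, fourState, {0}, isDeterministic, rfl, nonempty_iso_coBuchi⟩,
    fun h => ?_⟩
  obtain ⟨_, _, M, hM⟩ := exists_dfa_of_mem_DB h
  rw [coBuchiLanguage_eq] at hM
  exact not_prefixLimit_compl _ hM

end fourState

theorem mainTheorem4 :
    -- inclusions and the equality, over every alphabet
    (∀ (α : Type*) [Finite α],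
      DB α ∩ DC α ⊆ IB α ∧
      DB α ∩ DC α ⊆ IC α ∧
      DB α ∩ DC α = IB α ∩ IC α) ∧
    -- strictness, witnessed by the four-state automaton with marked set `{0}`
    (fourState.IsDeterministic ∧
      Nonempty ((rightcon (fourState.buchiLanguage {0})).Iso fourState) ∧
      fourState.buchiLanguage {0} ∈ IB (Fin 3) \ DC (Fin 3) ∧
      DB (Fin 3) ∩ DC (Fin 3) ⊂ IB (Fin 3)) ∧
    (Nonempty ((rightcon (fourState.coBuchiLanguage {0})).Iso fourState) ∧
      fourState.coBuchiLanguage {0} ∈ IC (Fin 3) \ DB (Fin 3) ∧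
      DB (Fin 3) ∩ DC (Fin 3) ⊂ IC (Fin 3)) := by
  refine ⟨fun α _ => ⟨?_, ?_, ?_⟩,
    ⟨fourState.isDeterministic, fourState.nonempty_iso_buchi, fourState.buchiLanguage_mem, ?_⟩,
    fourState.nonempty_iso_coBuchi, fourState.coBuchiLanguage_mem, ?_⟩
  · exact fun L h => (mem_IB_and_mem_IC_of_mem_DB_of_mem_DC h.1 h.2).1
  · exact fun L h => (mem_IB_and_mem_IC_of_mem_DB_of_mem_DC h.1 h.2).2
  · exact Set.Subset.antisymm (fun L h => mem_IB_and_mem_IC_of_mem_DB_of_mem_DC h.1 h.2)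
      (Set.inter_subset_inter IB_subset_DB IC_subset_DC)
  · exact Set.ssubset_iff_exists.2
      ⟨fun L h => (mem_IB_and_mem_IC_of_mem_DB_of_mem_DC h.1 h.2).1,
        _, fourState.buchiLanguage_mem.1, fun h => fourState.buchiLanguage_mem.2 h.2⟩
  · exact Set.ssubset_iff_exists.2
      ⟨fun L h => (mem_IB_and_mem_IC_of_mem_DB_of_mem_DC h.1 h.2).2,
        _, fourState.coBuchiLanguage_mem.1, fun h => fourState.coBuchiLanguage_mem.2 h.1⟩
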